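/- Let $N, L \ge 1$ be integers, $p \ge 0$ (transmit power), $\alpha_s \ge 0$, let $\mathbf h_s \in \mathbb C^N$ (the sensing channel vector) and let $\mathbf w \in \mathbb C^N$ with $\|\mathbf w\|^2 = 1$ (the beamformer). On a probability space let $\mathbf s$ be a (possibly deterministic) random vector in $\mathbb C^L$ with $L^{-1}\|\mathbf s\|^2 = 1$ almost surely, let $\beta \sim \mathcal{CN}(0,\alpha_s)$, and let $\mathbf N_s$ be a random matrix in $\mathbb C^{N\times L}$ with i.i.d. $\mathcal{CN}(0,1)$ entries, with $\mathbf s$, $\beta$, $\mathbf N_s$ mutually independent. Here $\mathcal{CN}(0,v)$ denotes the circularly-symmetric complex Gaussian law of variance $v$. Put $$\mathbf X = \sqrt p\,\mathbf w\,\mathbf s^{\mathsf H} \in \mathbb C^{N\times L}, \qquad \mathbf G = \beta\,\mathbf h_s\mathbf h_s^{\mathsf T}, \qquad \mathbf Y_s = \mathbf G\mathbf X + \mathbf N_s .$$ Let $I(\mathbf Y_s;\beta\mid\mathbf X)$ be the conditional mutual information in bits, i.e. $\frac{1}{\ln 2}$ times the average over the law of $\mathbf X$ of the Kullback–Leibler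 divergence (in nats) of the conditional law of $(\mathbf Y_s,\beta)$ given $\mathbf X$ from the product of the conditional laws of $\mathbf Y_s$ and of $\beta$ given $\mathbf X$. Then the downlink sensing rate $\mathcal R_{d,s} = L^{-1} I(\mathbf Y_s;\beta\mid\mathbf X)$ is finite and $$\mathcal R_{d,s} = \frac1L\log_2\!\left(1 + pL\alpha_s\|\mathbf h_s\|^2\,|\mathbf h_s^{\mathsf T}\mathbf w|^2\right).$$ -/

import Mathlib

open MeasureTheory ProbabilityTheory InformationTheory Matrix
open scoped ENNReal NNReal

noncomputable section

namespace ISAC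

/-- The circularly-symmetric complex Gaussian law `CN(0, v)` on `ℂ`: the real and imaginary parts are
independent real Gaussians with mean `0` and variance `v / 2` each. -/
def complexGaussian (v : ℝ≥0) : Measure ℂ :=
  ((gaussianReal 0 (v / 2)).prod (gaussianReal 0 (v / 2))).map Complex.measurableEquivRealProd.symm

/-- The matrix space `ℂ^{m × n}` carries the product σ-algebra. -/
instance matrixMeasurableSpace (m n : ℕ) : MeasurableSpace (Matrix (Fin m) (Fin n) ℂ) :=
  inferInstanceAs (MeasurableSpace (Fin m → Fin n → ℂ))

instance matrixStandardBorel (m n : ℕ) : StandardBorelSpace (Matrix (Fin m) (Fin n) ℂ) :=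
  inferInstanceAs (StandardBorelSpace (Fin m → Fin n → ℂ))

/-- Conditional mutual information `I(U; V | Z)` in bits, with values in `[0, ∞]`: the average over
the law of `Z` of the Kullback-Leibler divergence (in nats) of the conditional joint law of `(U, V)`
given `Z = z` from the product of the conditional laws of `U` and of `V` given `Z = z`,
divided by `log 2`. -/
def condMutualInfo {Ω 𝒰 𝒱 𝒵 : Type*} [MeasurableSpace Ω]
    [MeasurableSpace 𝒰] [StandardBorelSpace 𝒰] [Nonempty 𝒰]
    [MeasurableSpace 𝒱] [StandardBorelSpace 𝒱] [Nonempty 𝒱] [MeasurableSpace 𝒵]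
    (U : Ω → 𝒰) (V : Ω → 𝒱) (Z : Ω → 𝒵) (μ : Measure Ω) [IsFiniteMeasure μ] : ℝ≥0∞ :=
  (∫⁻ z, klDiv (condDistrib (fun ω => (U ω, V ω)) Z μ z)
      ((condDistrib U Z μ z).prod (condDistrib V Z μ z)) ∂(μ.map Z)) / ENNReal.ofReal (Real.log 2)

/-- The transmitted signal matrix `X = √p w sᴴ ∈ ℂ^{N × L}`. -/
def signal {N L : ℕ} (p : ℝ) (w : EuclideanSpace ℂ (Fin N)) (s : EuclideanSpace ℂ (Fin L)) :
    Matrix (Fin N) (Fin L) ℂ :=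
  (Real.sqrt p : ℂ) • vecMulVec w.ofLp (star s.ofLp)

/-- The target response matrix `G = β h hᵀ ∈ ℂ^{N × N}`. -/
def targetResponse {N : ℕ} (h : EuclideanSpace ℂ (Fin N)) (β : ℂ) : Matrix (Fin N) (Fin N) ℂ :=
  β • vecMulVec h.ofLp h.ofLp

/-- The received echo `Y = G X + N`, where `G` is the target response matrix and `N` the noise. -/
def echo {N L : ℕ} (h : EuclideanSpace ℂ (Fin N)) (β : ℂ) (X W : Matrix (Fin N) (Fin L) ℂ) :
    Matrix (Fin N) (Fin L) ℂ :=
  targetResponse h β * X + W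

/-- The downlink sensing rate `L⁻¹ I(Y; β | X)` (bits per unit time), for the random data stream `s`,
the random target amplitude `β` and the random noise matrix `W`. -/
def sensingRate {Ω : Type*} [MeasurableSpace Ω] {N L : ℕ} (μ : Measure Ω) [IsFiniteMeasure μ]
    (p : ℝ) (h w : EuclideanSpace ℂ (Fin N)) (s : Ω → EuclideanSpace ℂ (Fin L)) (β : Ω → ℂ)
    (W : Ω → Matrix (Fin N) (Fin L) ℂ) : ℝ≥0∞ :=
  (L : ℝ≥0∞)⁻¹ *
    condMutualInfo (fun ω => echo h (β ω) (signal p w (s ω)) (W ω)) β (fun ω => signal p w (s ω)) μ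

end ISAC

end

/-! Given `X = x`, the pair of amplitude and noise keeps its law by independence
(`condDistrib_of_indepFun`), and the echo is `b • A + noise` with `A = h hᵀ x`: a scalar Gaussian
channel along the direction `A`.

By the Cameron–Martin formula, translating the noise law by `b • A` gives the density `exp (2 Re
(conj b * T) - ‖b‖² c)`, where `T y = ⟨A, y⟩` and `c = ‖A‖²` (Frobenius). Only `T` and `c` enter the
divergence. Averaging this density over `b ∼ CN(0, α)` gives the output density `(1 + αc)⁻¹ exp
(α‖T‖² / (1 + αc))`. The logarithm of the quotient is `log (1 + αc)` plus a quadratic expression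
whose mean under the joint law is zero, so the divergence is `log (1 + αc)`
(`klDiv_gaussian_channel`).

Finally `A` has rank one and `‖s‖² = L` almost surely, so `c = p L ‖h‖² |hᵀw|²` for almost every `x`
(`frobeniusSq_vecMulVec_mul_signal`), and the average over `X` is that of a constant. Finiteness is
part of the equality with `ENNReal.ofReal`. -/

namespace ISAC

open Real Complex
open scoped ComplexConjugate

/-! ### Gaussian integrals and densities of translates -/

/-- The centred real Gaussian law tilted by a Gaussian weight. -/
theorem lintegral_exp_quadratic_gaussianReal (v : ℝ≥0) {c : ℝ} (hc : 0 ≤ c) (t : ℝ) :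
    ∫⁻ u, ENNReal.ofReal (rexp (2 * (u * t) - u ^ 2 * c)) ∂(gaussianReal 0 (v / 2)) =
      ENNReal.ofReal ((√(1 + v * c))⁻¹ * rexp (v * t ^ 2 / (1 + v * c))) := by
  -- At variance zero the law is a Dirac mass and has no density.
  by_cases hv : v = 0
  · subst hv
    simp
  have hv0 : (0 : ℝ) < v := by positivity
  have hv2 : v / 2 ≠ 0 := by positivity
  have hpos : 0 < 1 + v * c := by positivity
  set d : ℝ≥0 := ⟨1 + v * c, hpos.le⟩
  have hdc : (d : ℝ) = 1 + v * c := rfl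
  have hd0 : d ≠ 0 := by
    intro h; rw [h] at hdc; simp at hdc; linarith
  rw [gaussianReal_of_var_ne_zero _ hv2, lintegral_withDensity_eq_lintegral_mul _
    (measurable_gaussianPDF _ _) (by fun_prop)]
  -- Completing the square: the weighted density is a constant times another Gaussian density, whose
  -- integral is 1.
  have key : ∀ u : ℝ, (gaussianPDF 0 (v / 2) * fun u => ENNReal.ofReal
      (rexp (2 * (u * t) - u ^ 2 * c))) u =
      ENNReal.ofReal ((√(1 + v * c))⁻¹ * rexp (v * t ^ 2 / (1 + v * c))) *
        gaussianPDF (v * t / (1 + v * c)) (v / 2 / d) u := by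
    intro u
    rw [Pi.mul_apply, gaussianPDF, gaussianPDF, ← ENNReal.ofReal_mul (gaussianPDFReal_nonneg _ _ _),
      ← ENNReal.ofReal_mul (by positivity)]
    congr 1
    rw [gaussianPDFReal, gaussianPDFReal]
    push_cast
    rw [hdc]
    have h1 : √(2 * π * (v / 2 / (1 + v * c))) = √(2 * π * (v / 2)) / √(1 + v * c) := by
      rw [← Real.sqrt_div (by positivity)]; congr 1; ring
    have h2 : √(1 + v * c) ≠ 0 := by positivity
    rw [h1, inv_div, mul_assoc, ← Real.exp_add, mul_mul_mul_comm, ← Real.exp_add]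
    have h3 : (√(1 + v * c))⁻¹ * (√(1 + v * c) / √(2 * π * (v / 2))) =
        (√(2 * π * (v / 2)))⁻¹ := by
      field_simp
    rw [h3]
    congr 2
    field_simp
    ring
  simp_rw [key]
  rw [lintegral_const_mul _ (measurable_gaussianPDF _ _), lintegral_gaussianPDF_eq_one _
    (by positivity), mul_one]

/-- The density of a translate of the real Gaussian law of variance `1 / 2`. -/
theorem gaussianReal_half_map_add_const (a : ℝ) :
    (gaussianReal 0 (1 / 2)).map (· + a) = (gaussianReal 0 (1 / 2)).withDensity
      (fun u => ENNReal.ofReal (rexp (2 * (a * u) - a ^ 2))) := by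
  have h2 : (1 / 2 : ℝ≥0) ≠ 0 := by positivity
  rw [gaussianReal_map_add_const, gaussianReal_of_var_ne_zero _ h2, gaussianReal_of_var_ne_zero _ h2,
    ← withDensity_mul _ (measurable_gaussianPDF _ _) (by fun_prop)]
  congr 1
  ext u
  rw [Pi.mul_apply, gaussianPDF, gaussianPDF, ← ENNReal.ofReal_mul (gaussianPDFReal_nonneg _ _ _)]
  congr 1
  rw [gaussianPDFReal, gaussianPDFReal, mul_assoc (_)⁻¹, ← Real.exp_add]
  push_cast
  congr 2
  ring

instance isProbabilityMeasure_complexGaussian (v : ℝ≥0) :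
    IsProbabilityMeasure (complexGaussian v) :=
  Measure.isProbabilityMeasure_map (by fun_prop)

theorem lintegral_complexGaussian (v : ℝ≥0) {f : ℂ → ℝ≥0∞} (hf : Measurable f) :
    ∫⁻ z, f z ∂(complexGaussian v) =
      ∫⁻ x, ∫⁻ y, f ⟨x, y⟩ ∂(gaussianReal 0 (v / 2)) ∂(gaussianReal 0 (v / 2)) := by
  rw [complexGaussian, lintegral_map hf (by fun_prop), lintegral_prod _ (by fun_prop)]
  rfl

theorem hasLaw_re_complexGaussian (v : ℝ≥0) :
    HasLaw Complex.re (gaussianReal 0 (v / 2)) (complexGaussian v) where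
  map_eq := by
    rw [complexGaussian, Measure.map_map (by fun_prop) (by fun_prop)]
    change Measure.map Prod.fst _ = _
    simp

theorem hasLaw_im_complexGaussian (v : ℝ≥0) :
    HasLaw Complex.im (gaussianReal 0 (v / 2)) (complexGaussian v) where
  map_eq := by
    rw [complexGaussian, Measure.map_map (by fun_prop) (by fun_prop)]
    change Measure.map Prod.snd _ = _
    simp

/-- The centred complex Gaussian law tilted by a Gaussian weight. -/
theorem lintegral_exp_quadratic_complexGaussian (v : ℝ≥0) {c : ℝ} (hc : 0 ≤ c) (t : ℂ) :
    ∫⁻ b, ENNReal.ofReal (rexp (2 * (conj b * t).re - ‖b‖ ^ 2 * c)) ∂(complexGaussian v) =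
      ENNReal.ofReal ((1 + v * c)⁻¹ * rexp (v * ‖t‖ ^ 2 / (1 + v * c))) := by
  have hpos : 0 < 1 + v * c := by positivity
  rw [lintegral_complexGaussian v (by fun_prop)]
  have key : ∀ x y : ℝ, ENNReal.ofReal
      (rexp (2 * (conj (⟨x, y⟩ : ℂ) * t).re - ‖(⟨x, y⟩ : ℂ)‖ ^ 2 * c)) =
      ENNReal.ofReal (rexp (2 * (x * t.re) - x ^ 2 * c)) *
        ENNReal.ofReal (rexp (2 * (y * t.im) - y ^ 2 * c)) := by
    intro x y
    rw [← ENNReal.ofReal_mul (by positivity), ← Real.exp_add, ← Complex.normSq_eq_norm_sq,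
      Complex.normSq_mk]
    congr 2
    simp
    ring
  simp_rw [key]
  rw [lintegral_lintegral_mul (by fun_prop) (by fun_prop),
    lintegral_exp_quadratic_gaussianReal v hc, lintegral_exp_quadratic_gaussianReal v hc,
    ← ENNReal.ofReal_mul (by positivity), mul_mul_mul_comm, ← Real.exp_add, ← mul_inv,
    Real.mul_self_sqrt hpos.le, ← Complex.normSq_eq_norm_sq, Complex.normSq_apply]
  congr 3
  ring

/-- The density of a translate of the standard complex Gaussian law. -/
theorem complexGaussian_map_add_const (a : ℂ) :
    (complexGaussian 1).map (· + a) = (complexGaussian 1).withDensity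
      (fun z => ENNReal.ofReal (rexp (2 * (conj a * z).re - ‖a‖ ^ 2))) := by
  refine Measure.ext_of_lintegral _ fun f hf => ?_
  rw [lintegral_map hf (by fun_prop), lintegral_complexGaussian 1 (by fun_prop),
    lintegral_withDensity_eq_lintegral_mul _ (by fun_prop) hf,
    lintegral_complexGaussian 1 (by fun_prop)]
  have shift : ∀ (r : ℝ) (g : ℝ → ℝ≥0∞), Measurable g →
      ∫⁻ x, g (x + r) ∂(gaussianReal 0 (1 / 2)) =
        ∫⁻ x, ENNReal.ofReal (rexp (2 * (r * x) - r ^ 2)) * g x ∂(gaussianReal 0 (1 / 2)) := by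
    intro r g hg
    rw [← lintegral_map (f := g) (g := (· + r)) hg (by fun_prop), gaussianReal_half_map_add_const,
      lintegral_withDensity_eq_lintegral_mul _ (by fun_prop) hg]
    rfl
  have hmk : Measurable fun q : ℝ × ℝ => (⟨q.1, q.2⟩ : ℂ) :=
    Complex.measurableEquivRealProd.symm.measurable
  have e1 : ∀ x y : ℝ, (⟨x, y⟩ : ℂ) + a = ⟨x + a.re, y + a.im⟩ := fun x y => rfl
  have hf2 : Measurable fun q : ℝ × ℝ => f ⟨q.1, q.2⟩ := hf.comp hmk
  have hf1 : ∀ x : ℝ, Measurable fun y : ℝ => f ⟨x, y⟩ := fun x =>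
    hf2.comp measurable_prodMk_left
  simp_rw [e1]
  rw [shift a.re (fun x => ∫⁻ y, f ⟨x, y + a.im⟩ ∂(gaussianReal 0 (1 / 2)))
    (Measurable.lintegral_prod_right' (f := fun q : ℝ × ℝ => f ⟨q.1, q.2 + a.im⟩)
      (hf2.comp (by fun_prop : Measurable fun q : ℝ × ℝ => (q.1, q.2 + a.im))))]
  refine lintegral_congr fun x => ?_
  rw [shift a.im (fun y => f ⟨x, y⟩) (hf1 x), ← lintegral_const_mul _ (by fun_prop)]
  refine lintegral_congr fun y => ?_
  rw [Pi.mul_apply, ← mul_assoc, ← ENNReal.ofReal_mul (by positivity), ← Real.exp_add,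
    ← Complex.normSq_eq_norm_sq, Complex.normSq_apply]
  congr 3
  simp
  ring

/-- The density of a translate of the standard Gaussian law on `ι → ℂ`. -/
theorem pi_complexGaussian_map_add_const {ι : Type*} [Fintype ι] (a : ι → ℂ) :
    (Measure.pi fun _ : ι => complexGaussian 1).map (· + a) =
      (Measure.pi fun _ : ι => complexGaussian 1).withDensity
        (fun z => ENNReal.ofReal
          (rexp (2 * (∑ i, conj (a i) * z i).re - ∑ i, ‖a i‖ ^ 2))) := by
  set ν := Measure.pi fun _ : ι => complexGaussian 1
  set g : ι → ℂ → ℝ≥0∞ := fun i z => ENNReal.ofReal (rexp (2 * (conj (a i) * z).re - ‖a i‖ ^ 2))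
  have hg : ∀ i, Measurable (g i) := fun i => by fun_prop
  have hdens : (fun z : ι → ℂ => ENNReal.ofReal
      (rexp (2 * (∑ i, conj (a i) * z i).re - ∑ i, ‖a i‖ ^ 2))) = fun z => ∏ i, g i (z i) := by
    ext z
    rw [← ENNReal.ofReal_prod_of_nonneg (fun i _ => by positivity), ← Real.exp_sum, Complex.re_sum,
      Finset.sum_sub_distrib, Finset.mul_sum]
  have hmap : ν.map (· + a) = Measure.pi fun i => (complexGaussian 1).map (· + a i) :=
    Measure.pi_map_pi (f := fun i z => z + a i) (fun i => by fun_prop)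
  rw [hmap]
  have : ∀ i, IsProbabilityMeasure ((complexGaussian 1).map (· + a i)) := fun i =>
    Measure.isProbabilityMeasure_map (by fun_prop)
  refine Measure.pi_eq fun s hs => ?_
  -- On a box the indicator also splits over coordinates, so the integral of the product density
  -- becomes a product of one-dimensional integrals.
  have hind : iIndepFun (fun i (z : ι → ℂ) => (s i).indicator (g i) (z i)) ν :=
    iIndepFun_pi (X := fun i => (s i).indicator (g i))
      (fun i => ((hg i).indicator (hs i)).aemeasurable)
  rw [withDensity_apply _ (MeasurableSet.univ_pi hs), ← lintegral_indicator
    (MeasurableSet.univ_pi hs), hdens]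
  have hprod : (Set.univ.pi s).indicator (fun z => ∏ i, g i (z i)) =
      fun z => ∏ i, (s i).indicator (g i) (z i) := by
    classical
    ext z
    by_cases hz : z ∈ Set.univ.pi s
    · rw [Set.indicator_of_mem hz]
      exact Finset.prod_congr rfl fun i _ =>
        (Set.indicator_of_mem (hz i (Set.mem_univ i)) (g i)).symm
    · rw [Set.indicator_of_notMem hz]
      simp only [Set.mem_pi, Set.mem_univ, true_imp_iff, not_forall] at hz
      obtain ⟨i, hi⟩ := hz
      exact (Finset.prod_eq_zero (Finset.mem_univ i) (Set.indicator_of_notMem hi _)).symm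
  rw [hprod, lintegral_prod_eq_prod_lintegral_of_indepFun Finset.univ _ hind
    (fun i => ((hg i).indicator (hs i)).comp (measurable_pi_apply i))]
  refine Finset.prod_congr rfl fun i _ => ?_
  rw [complexGaussian_map_add_const, withDensity_apply _ (hs i), ← lintegral_indicator (hs i)]
  exact (measurePreserving_eval (fun _ : ι => complexGaussian 1) i).lintegral_comp
    ((hg i).indicator (hs i))

/-! ### Moments and recognition of real Gaussian variables -/

section Moments

variable {E : Type*} [MeasurableSpace E] {ν : Measure E} {R : E → ℝ} {v : ℝ≥0}

theorem memLp_of_hasLaw_gaussianReal (hR : HasLaw R (gaussianReal 0 v) ν) : MemLp R 2 ν := by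
  have h := memLp_id_gaussianReal' (μ := 0) (v := v) 2 (by simp)
  rw [← hR.map_eq] at h
  exact (memLp_map_measure_iff (by fun_prop) hR.aemeasurable).1 h

theorem integral_of_hasLaw_gaussianReal (hR : HasLaw R (gaussianReal 0 v) ν) :
    ∫ x, R x ∂ν = 0 := by
  rw [hR.integral_eq, integral_id_gaussianReal]

theorem integral_sq_of_hasLaw_gaussianReal (hR : HasLaw R (gaussianReal 0 v) ν) :
    ∫ x, R x ^ 2 ∂ν = v := by
  have h := variance_id_gaussianReal (μ := 0) (v := v)
  rw [variance_eq_integral (by fun_prop)] at h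
  simp only [id, integral_id_gaussianReal, sub_zero] at h
  rw [← h, ← hR.integral_comp (f := fun x => x ^ 2) (by fun_prop)]
  rfl

/-- A real random variable with a Gaussian moment generating function is Gaussian. -/
theorem hasLaw_gaussianReal_of_mgf [IsProbabilityMeasure ν] (hR : Measurable R)
    (h : ∀ t, mgf R ν t = rexp (v * t ^ 2 / 2)) : HasLaw R (gaussianReal 0 v) ν where
  aemeasurable := hR.aemeasurable
  map_eq := by
    have hm : mgf R ν = mgf id (gaussianReal 0 v) := by
      ext t
      rw [h, mgf_id_gaussianReal]
      simp
    -- Exponential integrability everywhere extends the equality of the two moment generating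
    -- functions to the whole complex plane, and this determines the law.
    have hset : integrableExpSet R ν = Set.univ := by
      rw [integrableExpSet_eq_of_mgf hm]
      simp
    have hc := eqOn_complexMGF_of_mgf hm
    rw [hset] at hc
    have := Measure.ext_of_complexMGF_eq hR.aemeasurable (by fun_prop)
      (funext fun z => hc (by simp) : complexMGF R ν = complexMGF id (gaussianReal 0 v))
    simpa using this

end Moments

/-! ### The scalar Gaussian channel -/

section Channel

variable {E : Type*} [MeasurableSpace E] {ν : Measure E} [IsProbabilityMeasure ν]
  {φ : ℂ × E → E} {T : E → ℂ} {c : ℝ≥0}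

/-- If `T` is the log-likelihood of a one-parameter family of translates of `ν`, then every real
component of `T` is Gaussian under `ν`. -/
theorem hasLaw_re_conj_mul (hφ : Measurable φ) (hT : Measurable T)
    (hshift : ∀ b, ν.map (fun y => φ (b, y)) = ν.withDensity
      (fun y => ENNReal.ofReal (rexp (2 * (conj b * T y).re - ‖b‖ ^ 2 * c))))
    (e : ℂ) (he : ‖e‖ = 1) :
    HasLaw (fun y => (conj e * T y).re) (gaussianReal 0 (c / 2)) ν := by
  refine hasLaw_gaussianReal_of_mgf (by fun_prop) fun t => ?_
  -- Compare total masses in `hshift` at `b = (t / 2) e`. The resulting moment generating function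
  -- `exp (c t² / 4)` is that of variance `c / 2`.
  have h1 : ∫⁻ y, ENNReal.ofReal (rexp (t * (conj e * T y).re - t ^ 2 / 4 * c)) ∂ν = 1 := by
    have h := congrArg (fun m => m Set.univ) (hshift ((t / 2 : ℝ) * e))
    simp only [withDensity_apply _ MeasurableSet.univ, Measure.restrict_univ] at h
    rw [Measure.map_apply (by fun_prop) MeasurableSet.univ, Set.preimage_univ, measure_univ] at h
    rw [h]
    refine lintegral_congr fun y => ?_
    rw [map_mul, Complex.conj_ofReal, mul_assoc, Complex.re_ofReal_mul, norm_mul, he,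
      Complex.norm_real, mul_one, Real.norm_eq_abs, sq_abs]
    congr 2
    ring
  have h2 : ∫ y, rexp (t * (conj e * T y).re - t ^ 2 / 4 * c) ∂ν = 1 := by
    rw [integral_eq_lintegral_of_nonneg_ae (ae_of_all _ fun y => by positivity)
      (by fun_prop), h1]
    simp
  simp_rw [Real.exp_sub, integral_div] at h2
  rw [mgf, (div_eq_one_iff_eq (by positivity)).1 h2]
  congr 1
  push_cast
  ring

/-- The information transmitted over the Gaussian channel `b ↦ φ (b, y)`, with Gaussian input `b`
and noise `y ∼ ν`, where `c` is the squared length of the direction of translation. -/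
theorem klDiv_gaussian_channel (hφ : Measurable φ) (hT : Measurable T)
    (hshift : ∀ b, ν.map (fun y => φ (b, y)) = ν.withDensity
      (fun y => ENNReal.ofReal (rexp (2 * (conj b * T y).re - ‖b‖ ^ 2 * c))))
    (hTφ : ∀ b y, T (φ (b, y)) = c * b + T y) (α : ℝ≥0) :
    klDiv (((complexGaussian α).prod ν).map fun q => (φ q, q.1))
      ((((complexGaussian α).prod ν).map φ).prod (complexGaussian α)) =
      ENNReal.ofReal (Real.log (1 + α * c)) := by
  set γ := complexGaussian α
  set J := (γ.prod ν).map fun q => (φ q, q.1) with hJ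
  set M := (γ.prod ν).map φ
  have hpos : (0 : ℝ) < 1 + α * c := by positivity
  have : IsProbabilityMeasure J := Measure.isProbabilityMeasure_map (by fun_prop)
  have : IsProbabilityMeasure M := Measure.isProbabilityMeasure_map (by fun_prop)
  set ℓ : E × ℂ → ℝ := fun q => 2 * (conj q.2 * T q.1).re - ‖q.2‖ ^ 2 * c with hℓ
  set k : E → ℝ := fun y => (1 + α * c : ℝ)⁻¹ * rexp (α * ‖T y‖ ^ 2 / (1 + α * c)) with hk
  have hℓm : Measurable ℓ := by fun_prop
  have hkm : Measurable k := by fun_prop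
  have hk0 : ∀ y, 0 < k y := fun y => by positivity
  have hJd : J = (ν.prod γ).withDensity fun q => ENNReal.ofReal (rexp (ℓ q)) := by
    refine Measure.ext_of_lintegral _ fun f hf => ?_
    rw [lintegral_map hf (by fun_prop), lintegral_prod _ (by fun_prop),
      lintegral_withDensity_eq_lintegral_mul _ (by fun_prop) hf,
      lintegral_prod_symm _ (by fun_prop)]
    refine lintegral_congr fun b => ?_
    rw [← lintegral_map (f := fun y => f (y, b)) (g := fun y => φ (b, y)) (by fun_prop)
      (by fun_prop), hshift, lintegral_withDensity_eq_lintegral_mul _ (by fun_prop) (by fun_prop)]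
    rfl
  -- The output law is a marginal of `J`, so its density is that of `J` integrated over `b`.
  have hMd : M = ν.withDensity fun y => ENNReal.ofReal (k y) := by
    have hfst : M = J.map Prod.fst := by
      rw [hJ, Measure.map_map measurable_fst (by fun_prop)]
      rfl
    refine Measure.ext_of_lintegral _ fun f hf => ?_
    rw [hfst, lintegral_map hf measurable_fst, hJd,
      lintegral_withDensity_eq_lintegral_mul _ (by fun_prop) (by fun_prop),
      lintegral_withDensity_eq_lintegral_mul _ (by fun_prop) hf,
      lintegral_prod _ (by fun_prop)]
    refine lintegral_congr fun y => ?_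
    simp only [Pi.mul_apply]
    rw [lintegral_mul_const _ (by fun_prop), hk]
    congr 1
    exact lintegral_exp_quadratic_complexGaussian α c.coe_nonneg (T y)
  have hJM : J = (M.prod γ).withDensity fun q => ENNReal.ofReal (rexp (ℓ q) / k q.1) := by
    rw [hMd, prod_withDensity_left (by fun_prop), ← withDensity_mul _ (by fun_prop) (by fun_prop),
      hJd]
    congr 1
    ext q
    rw [Pi.mul_apply, ← ENNReal.ofReal_mul (hk0 _).le, mul_div_cancel₀ _ (hk0 _).ne']
  have hac : J ≪ M.prod γ := by
    rw [hJM]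
    exact withDensity_absolutelyContinuous _ _
  have hllr : llr J (M.prod γ) =ᵐ[J] fun q => Real.log (1 + α * c) +
      (ℓ q - α * ‖T q.1‖ ^ 2 / (1 + α * c)) := by
    have h := Measure.rnDeriv_withDensity (M.prod γ)
      (f := fun q => ENNReal.ofReal (rexp (ℓ q) / k q.1)) (by fun_prop)
    rw [← hJM] at h
    filter_upwards [hac.ae_le h] with q hq
    rw [llr, hq, ENNReal.toReal_ofReal (by have := hk0 q.1; positivity), hk,
      Real.log_div (by positivity) (by positivity), Real.log_exp,
      Real.log_mul (by positivity) (by positivity), Real.log_inv, Real.log_exp]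
    ring
  -- In the coordinates `(b, y)`, where `b` and `T y` are independent, `hTφ` turns the exponent into
  -- `(1 + αc)⁻¹ (c‖b‖² + 2 Re (conj b * T y) - α‖T y‖²)`. Its mean vanishes: `E‖b‖² = α`, `E‖T‖² =
  -- c`, and the cross term is centred.
  have hpull : (fun q : ℂ × E => ℓ (φ q, q.1) - α * ‖T (φ q)‖ ^ 2 / (1 + α * c)) =
      fun q => (1 + α * c : ℝ)⁻¹ * (c * (q.1.re ^ 2 + q.1.im ^ 2) +
        2 * (q.1.re * (T q.2).re + q.1.im * (T q.2).im) -
        α * ((T q.2).re ^ 2 + (T q.2).im ^ 2)) := by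
    ext ⟨b, y⟩
    simp only [hℓ, hTφ, ← Complex.normSq_eq_norm_sq, Complex.normSq_apply]
    simp
    field_simp
    ring
  have hTre : HasLaw (fun y => (T y).re) (gaussianReal 0 (c / 2)) ν := by
    simpa using hasLaw_re_conj_mul hφ hT hshift 1 (by simp)
  have hTim : HasLaw (fun y => (T y).im) (gaussianReal 0 (c / 2)) ν := by
    simpa using hasLaw_re_conj_mul hφ hT hshift Complex.I (by simp)
  have hbre := hasLaw_re_complexGaussian α
  have hbim := hasLaw_im_complexGaussian α
  have i1 : Integrable (fun q : ℂ × E => q.1.re ^ 2) (γ.prod ν) :=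
    (memLp_of_hasLaw_gaussianReal hbre).integrable_sq.comp_fst ν
  have i2 : Integrable (fun q : ℂ × E => q.1.im ^ 2) (γ.prod ν) :=
    (memLp_of_hasLaw_gaussianReal hbim).integrable_sq.comp_fst ν
  have i3 : Integrable (fun q : ℂ × E => (T q.2).re ^ 2) (γ.prod ν) :=
    (memLp_of_hasLaw_gaussianReal hTre).integrable_sq.comp_snd γ
  have i4 : Integrable (fun q : ℂ × E => (T q.2).im ^ 2) (γ.prod ν) :=
    (memLp_of_hasLaw_gaussianReal hTim).integrable_sq.comp_snd γ
  have i5 : Integrable (fun q : ℂ × E => q.1.re * (T q.2).re) (γ.prod ν) :=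
    ((memLp_of_hasLaw_gaussianReal hbre).integrable (by simp)).mul_prod
      ((memLp_of_hasLaw_gaussianReal hTre).integrable (by simp))
  have i6 : Integrable (fun q : ℂ × E => q.1.im * (T q.2).im) (γ.prod ν) :=
    ((memLp_of_hasLaw_gaussianReal hbim).integrable (by simp)).mul_prod
      ((memLp_of_hasLaw_gaussianReal hTim).integrable (by simp))
  have v1 : ∫ q : ℂ × E, q.1.re ^ 2 ∂(γ.prod ν) = α / 2 := by
    rw [integral_fun_fst (fun b : ℂ => b.re ^ 2), integral_sq_of_hasLaw_gaussianReal hbre]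
    simp
  have v2 : ∫ q : ℂ × E, q.1.im ^ 2 ∂(γ.prod ν) = α / 2 := by
    rw [integral_fun_fst (fun b : ℂ => b.im ^ 2), integral_sq_of_hasLaw_gaussianReal hbim]
    simp
  have v3 : ∫ q : ℂ × E, (T q.2).re ^ 2 ∂(γ.prod ν) = c / 2 := by
    rw [integral_fun_snd (fun y => (T y).re ^ 2), integral_sq_of_hasLaw_gaussianReal hTre]
    simp
  have v4 : ∫ q : ℂ × E, (T q.2).im ^ 2 ∂(γ.prod ν) = c / 2 := by
    rw [integral_fun_snd (fun y => (T y).im ^ 2), integral_sq_of_hasLaw_gaussianReal hTim]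
    simp
  have v5 : ∫ q : ℂ × E, q.1.re * (T q.2).re ∂(γ.prod ν) = 0 := by
    rw [integral_prod_mul (fun b : ℂ => b.re) (fun y => (T y).re),
      integral_of_hasLaw_gaussianReal hbre, zero_mul]
  have v6 : ∫ q : ℂ × E, q.1.im * (T q.2).im ∂(γ.prod ν) = 0 := by
    rw [integral_prod_mul (fun b : ℂ => b.im) (fun y => (T y).im),
      integral_of_hasLaw_gaussianReal hbim, zero_mul]
  have hD : Measurable fun q : E × ℂ => ℓ q - α * ‖T q.1‖ ^ 2 / (1 + α * c) := by fun_prop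
  have j1 : Integrable (fun q : ℂ × E => (c : ℝ) * (q.1.re ^ 2 + q.1.im ^ 2)) (γ.prod ν) :=
    (i1.add i2).const_mul _
  have j2 : Integrable (fun q : ℂ × E => 2 * (q.1.re * (T q.2).re + q.1.im * (T q.2).im))
      (γ.prod ν) := (i5.add i6).const_mul _
  have j3 : Integrable (fun q : ℂ × E => (α : ℝ) * ((T q.2).re ^ 2 + (T q.2).im ^ 2)) (γ.prod ν) :=
    (i3.add i4).const_mul _
  have hDint : Integrable (fun q : E × ℂ => ℓ q - α * ‖T q.1‖ ^ 2 / (1 + α * c)) J := by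
    rw [hJ, integrable_map_measure hD.aestronglyMeasurable (by fun_prop)]
    change Integrable (fun q : ℂ × E => ℓ (φ q, q.1) - α * ‖T (φ q)‖ ^ 2 / (1 + α * c)) _
    rw [hpull]
    exact ((j1.add j2).sub j3).const_mul _
  have hzero : ∫ q, (ℓ q - α * ‖T q.1‖ ^ 2 / (1 + α * c)) ∂J = 0 := by
    rw [hJ, integral_map (by fun_prop) hD.aestronglyMeasurable]
    change ∫ q : ℂ × E, (ℓ (φ q, q.1) - α * ‖T (φ q)‖ ^ 2 / (1 + α * c)) ∂_ = _
    rw [hpull, integral_const_mul, integral_sub (by exact j1.add j2) j3, integral_add j1 j2,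
      integral_const_mul, integral_const_mul, integral_const_mul, integral_add i1 i2,
      integral_add i5 i6, integral_add i3 i4, v1, v2, v3, v4, v5, v6]
    ring
  -- The general formula also contains the difference of total masses, which cancels for probability
  -- measures.
  rw [klDiv_of_ac_of_integrable hac
    ((integrable_congr hllr).2 ((integrable_const _).add hDint)), integral_congr_ae hllr,
    integral_add (integrable_const _) hDint, hzero]
  simp

end Channel

/-! ### Conditional laws under independence -/

/-- The conditional law of `f (X, V)` given `X = x` is the law of `f (x, V)` if `X` and `V` are
independent. -/
theorem condDistrib_of_indepFun {Ω 𝒵 𝒱 𝒰 : Type*} [MeasurableSpace Ω] [MeasurableSpace 𝒵]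
    [MeasurableSpace 𝒱] [MeasurableSpace 𝒰] [StandardBorelSpace 𝒰] [Nonempty 𝒰]
    {μ : Measure Ω} [IsProbabilityMeasure μ] {X : Ω → 𝒵} {V : Ω → 𝒱} (hX : AEMeasurable X μ)
    (hV : AEMeasurable V μ) (hXV : IndepFun X V μ) {f : 𝒵 × 𝒱 → 𝒰} (hf : Measurable f) :
    ∀ᵐ x ∂(μ.map X), condDistrib (fun ω => f (X ω, V ω)) X μ x =
      (μ.map V).map fun v => f (x, v) := by
  have : IsProbabilityMeasure (μ.map V) := Measure.isProbabilityMeasure_map hV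
  set κ : Kernel 𝒵 𝒰 := (Kernel.id ×ₖ Kernel.const 𝒵 (μ.map V)).map f with hκ
  have hκa : ∀ x, κ x = (μ.map V).map fun v => f (x, v) := by
    intro x
    rw [hκ, Kernel.map_apply _ hf, Kernel.prod_apply, Kernel.id_apply, Kernel.const_apply,
      Measure.dirac_prod, Measure.map_map hf (by fun_prop)]
    rfl
  have : IsMarkovKernel κ := Kernel.IsMarkovKernel.map _ hf
  have key : μ.map (fun ω => (X ω, f (X ω, V ω))) = μ.map X ⊗ₘ κ := by
    refine Measure.ext_of_lintegral _ fun g hg => ?_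
    have h1 : μ.map (fun ω => (X ω, f (X ω, V ω))) =
        ((μ.map X).prod (μ.map V)).map fun q => (q.1, f q) := by
      rw [← (indepFun_iff_map_prod_eq_prod_map_map hX hV).1 hXV,
        AEMeasurable.map_map_of_aemeasurable (by fun_prop) (hX.prodMk hV)]
      rfl
    rw [h1, lintegral_map hg (by fun_prop), lintegral_prod _ (by fun_prop),
      Measure.lintegral_compProd hg]
    refine lintegral_congr fun x => ?_
    rw [hκa, lintegral_map (f := fun u => g (x, u)) (by fun_prop) (by fun_prop)]
  -- Disintegrations are almost everywhere unique, so `κ` is the conditional law.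
  filter_upwards [condDistrib_ae_eq_of_measure_eq_compProd X
    (hf.comp_aemeasurable (hX.prodMk hV)) key] with x hx
  rw [← hκa, ← hx]
  rfl

/-- Mutual independence of three random variables, regrouped. -/
theorem indepFun_prodMk_right {Ω 𝒜 ℬ 𝒞 : Type*} [MeasurableSpace Ω] [MeasurableSpace 𝒜]
    [MeasurableSpace ℬ] [MeasurableSpace 𝒞] {μ : Measure Ω} [IsProbabilityMeasure μ]
    {a : Ω → 𝒜} {b : Ω → ℬ} {c : Ω → 𝒞} (ha : AEMeasurable a μ) (hb : AEMeasurable b μ)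
    (hc : AEMeasurable c μ) (hab : IndepFun a b μ) (habc : IndepFun (fun ω => (a ω, b ω)) c μ) :
    IndepFun a (fun ω => (b ω, c ω)) μ ∧ IndepFun b c μ := by
  have hbc : IndepFun b c μ := habc.comp measurable_snd measurable_id
  refine ⟨?_, hbc⟩
  have := Measure.isProbabilityMeasure_map ha
  have := Measure.isProbabilityMeasure_map hb
  have := Measure.isProbabilityMeasure_map hc
  rw [indepFun_iff_map_prod_eq_prod_map_map ha (hb.prodMk hc),
    (indepFun_iff_map_prod_eq_prod_map_map hb hc).1 hbc, ← Measure.prodAssoc_prod,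
    ← (indepFun_iff_map_prod_eq_prod_map_map ha hb).1 hab,
    ← (indepFun_iff_map_prod_eq_prod_map_map (ha.prodMk hb) hc).1 habc,
    AEMeasurable.map_map_of_aemeasurable (by fun_prop) ((ha.prodMk hb).prodMk hc)]
  rfl

/-! ### Matrices, the echo and Gaussian noise -/

/-- The squared Frobenius norm of a complex matrix. -/
noncomputable def frobeniusSq {N L : ℕ} (A : Matrix (Fin N) (Fin L) ℂ) : ℝ≥0 :=
  ∑ q : Fin N × Fin L, ‖A q.1 q.2‖₊ ^ 2

/-- The squared Frobenius norm of the noiseless echo of a unit target amplitude. -/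
theorem frobeniusSq_vecMulVec_mul_signal {N L : ℕ} {p : ℝ} (hp : 0 ≤ p)
    (h w : EuclideanSpace ℂ (Fin N)) (s : EuclideanSpace ℂ (Fin L)) :
    (frobeniusSq (vecMulVec h.ofLp h.ofLp * signal p w s) : ℝ) =
      p * ‖s‖ ^ 2 * ‖h‖ ^ 2 * ‖h.ofLp ⬝ᵥ w.ofLp‖ ^ 2 := by
  -- The product has rank one, so its squared entries sum to a product of squared norms.
  have hA : ∀ i l, (vecMulVec h.ofLp h.ofLp * signal p w s) i l =
      h i * ((√p : ℂ) * (h.ofLp ⬝ᵥ w.ofLp)) * conj (s l) := by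
    intro i l
    simp only [Matrix.mul_apply, signal, Matrix.smul_apply, vecMulVec_apply, dotProduct,
      smul_eq_mul, Pi.star_apply, Finset.mul_sum, Finset.sum_mul]
    refine Finset.sum_congr rfl fun j _ => ?_
    simp only [RCLike.star_def]
    ring
  rw [frobeniusSq]
  push_cast
  simp_rw [hA, norm_mul, mul_pow, RCLike.norm_conj, Complex.norm_real, Real.norm_eq_abs, sq_abs,
    Real.sq_sqrt hp]
  rw [Fintype.sum_prod_type, EuclideanSpace.norm_sq_eq, EuclideanSpace.norm_sq_eq]
  simp_rw [← Finset.mul_sum, ← Finset.sum_mul]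
  ring

theorem measurable_entry {N L : ℕ} (i : Fin N) (l : Fin L) :
    Measurable fun A : Matrix (Fin N) (Fin L) ℂ => A i l :=
  (measurable_pi_apply l).comp (measurable_pi_apply (X := fun _ : Fin N => Fin L → ℂ) i)

theorem measurable_matrix {α : Type*} [MeasurableSpace α] {N L : ℕ}
    {f : α → Matrix (Fin N) (Fin L) ℂ} (hf : ∀ i l, Measurable fun a => f a i l) : Measurable f :=
  measurable_pi_lambda (X := fun _ : Fin N => Fin L → ℂ) f fun i =>
    measurable_pi_lambda _ fun l => hf i l

theorem aemeasurable_matrix {α : Type*} [MeasurableSpace α] {μ : Measure α} {N L : ℕ}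
    {f : α → Matrix (Fin N) (Fin L) ℂ} (hf : ∀ i l, AEMeasurable (fun a => f a i l) μ) :
    AEMeasurable f μ :=
  aemeasurable_pi_lambda (X := fun _ : Fin N => Fin L → ℂ) f fun i =>
    aemeasurable_pi_lambda _ fun l => hf i l

theorem measurable_signal {N L : ℕ} (p : ℝ) (w : EuclideanSpace ℂ (Fin N)) :
    Measurable (signal (L := L) p w) := by
  refine measurable_matrix fun i l => ?_
  simp only [signal, Matrix.smul_apply, vecMulVec_apply, smul_eq_mul, Pi.star_apply]
  fun_prop

theorem measurable_mul_left {N L : ℕ} (B : Matrix (Fin N) (Fin N) ℂ) :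
    Measurable fun x : Matrix (Fin N) (Fin L) ℂ => B * x := by
  refine measurable_matrix fun i l => ?_
  simp only [Matrix.mul_apply]
  exact Finset.measurable_sum _ fun j _ => (measurable_entry j l).const_mul _

theorem measurable_frobeniusSq {N L : ℕ} :
    Measurable (frobeniusSq : Matrix (Fin N) (Fin L) ℂ → ℝ≥0) :=
  Finset.measurable_sum _ fun q _ => (measurable_entry q.1 q.2).nnnorm.pow_const 2

theorem echo_eq {N L : ℕ} (h : EuclideanSpace ℂ (Fin N)) (b : ℂ)
    (x y : Matrix (Fin N) (Fin L) ℂ) :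
    echo h b x y = b • (vecMulVec h.ofLp h.ofLp * x) + y := by
  rw [echo, targetResponse, Matrix.smul_mul]

theorem measurable_echo {N L : ℕ} (h : EuclideanSpace ℂ (Fin N)) :
    Measurable fun q : Matrix (Fin N) (Fin L) ℂ × ℂ × Matrix (Fin N) (Fin L) ℂ =>
      echo h q.2.1 q.1 q.2.2 := by
  refine measurable_matrix fun i l => ?_
  simp only [echo_eq, Matrix.add_apply, Matrix.smul_apply, smul_eq_mul]
  have h1 : Measurable fun q : Matrix (Fin N) (Fin L) ℂ × ℂ × Matrix (Fin N) (Fin L) ℂ =>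
      (vecMulVec h.ofLp h.ofLp * q.1) i l :=
    (measurable_entry i l).comp ((measurable_mul_left _).comp measurable_fst)
  have h2 : Measurable fun q : Matrix (Fin N) (Fin L) ℂ × ℂ × Matrix (Fin N) (Fin L) ℂ =>
      q.2.2 i l :=
    (measurable_entry i l).comp measurable_snd.snd
  exact (measurable_snd.fst.mul h1).add h2

/-- The law of a matrix with independent standard complex Gaussian entries. -/
noncomputable def gaussianMatrix (N L : ℕ) : Measure (Matrix (Fin N) (Fin L) ℂ) :=
  (Measure.pi fun _ : Fin N × Fin L => complexGaussian 1).map fun z => Matrix.of fun i l => z (i, l)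

theorem measurable_of_curry (N L : ℕ) :
    Measurable fun z : Fin N × Fin L → ℂ => Matrix.of fun i l => z (i, l) :=
  measurable_matrix fun i l => measurable_pi_apply (i, l)

instance isProbabilityMeasure_gaussianMatrix (N L : ℕ) :
    IsProbabilityMeasure (gaussianMatrix N L) :=
  Measure.isProbabilityMeasure_map (measurable_of_curry N L).aemeasurable

theorem map_eq_gaussianMatrix {Ω : Type*} [MeasurableSpace Ω] {μ : Measure Ω}
    [IsProbabilityMeasure μ] {N L : ℕ} {W : Ω → Matrix (Fin N) (Fin L) ℂ}
    (hW : ∀ i l, HasLaw (fun ω => W ω i l) (complexGaussian 1) μ)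
    (hW_indep : iIndepFun (fun (il : Fin N × Fin L) ω => W ω il.1 il.2) μ) :
    μ.map W = gaussianMatrix N L := by
  have hm : ∀ il : Fin N × Fin L, AEMeasurable (fun ω => W ω il.1 il.2) μ :=
    fun il => (hW il.1 il.2).aemeasurable
  have h1 := (iIndepFun_iff_map_fun_eq_pi_map hm).1 hW_indep
  simp only [(hW _ _).map_eq] at h1
  rw [gaussianMatrix, ← h1, AEMeasurable.map_map_of_aemeasurable
    (measurable_of_curry N L).aemeasurable (aemeasurable_pi_lambda _ hm)]
  rfl

/-- The Frobenius inner product of complex matrices. -/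
noncomputable def frobeniusInner {N L : ℕ} (A B : Matrix (Fin N) (Fin L) ℂ) : ℂ :=
  ∑ q : Fin N × Fin L, conj (A q.1 q.2) * B q.1 q.2

theorem measurable_frobeniusInner {N L : ℕ} (A : Matrix (Fin N) (Fin L) ℂ) :
    Measurable (frobeniusInner A) :=
  Finset.measurable_sum _ fun q _ => (measurable_entry q.1 q.2).const_mul _

theorem frobeniusInner_smul_left {N L : ℕ} (b : ℂ) (A B : Matrix (Fin N) (Fin L) ℂ) :
    frobeniusInner (b • A) B = conj b * frobeniusInner A B := by
  simp only [frobeniusInner, Matrix.smul_apply, smul_eq_mul, map_mul, Finset.mul_sum, mul_assoc]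

theorem frobeniusSq_smul {N L : ℕ} (b : ℂ) (A : Matrix (Fin N) (Fin L) ℂ) :
    (frobeniusSq (b • A) : ℝ) = ‖b‖ ^ 2 * frobeniusSq A := by
  simp [frobeniusSq, Finset.mul_sum, mul_pow]

/-- Linearity in the second argument, with `⟨A, A⟩ = ‖A‖²`; it supplies `hTφ` in
`klDiv_gaussian_channel`. -/
theorem frobeniusInner_smul_add {N L : ℕ} (b : ℂ) (A B : Matrix (Fin N) (Fin L) ℂ) :
    frobeniusInner A (b • A + B) = frobeniusSq A * b + frobeniusInner A B := by
  simp only [frobeniusInner, Matrix.add_apply, Matrix.smul_apply, smul_eq_mul, mul_add,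
    Finset.sum_add_distrib, frobeniusSq]
  push_cast
  rw [Finset.sum_mul]
  congr 1
  refine Finset.sum_congr rfl fun q _ => ?_
  rw [← Complex.conj_mul']
  ring

/-- The density of a translate of the standard Gaussian law on complex matrices. -/
theorem gaussianMatrix_map_const_add {N L : ℕ} (A : Matrix (Fin N) (Fin L) ℂ) :
    (gaussianMatrix N L).map (fun y => A + y) = (gaussianMatrix N L).withDensity (fun y =>
      ENNReal.ofReal (rexp (2 * (frobeniusInner A y).re -
        frobeniusSq A))) := by
  have hC := measurable_of_curry N L
  have hadd : Measurable fun y : Matrix (Fin N) (Fin L) ℂ => A + y :=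
    measurable_matrix fun i l => (measurable_entry i l).const_add _
  have hd : Measurable fun y : Matrix (Fin N) (Fin L) ℂ =>
      ENNReal.ofReal (rexp (2 * (frobeniusInner A y).re -
        frobeniusSq A)) := by
    have := measurable_frobeniusInner A
    fun_prop
  refine Measure.ext_of_lintegral _ fun f hf => ?_
  rw [lintegral_map hf hadd, lintegral_withDensity_eq_lintegral_mul _ hd hf, gaussianMatrix,
    lintegral_map (f := fun y => f (A + y)) (hf.comp hadd) hC, lintegral_map (hd.mul hf) hC]
  have hfC : Measurable fun z : Fin N × Fin L → ℂ => f (Matrix.of fun i l => z (i, l)) :=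
    hf.comp hC
  have h1 := congrArg (fun m => ∫⁻ z, f (Matrix.of fun i l => z (i, l)) ∂m)
    (pi_complexGaussian_map_add_const fun q : Fin N × Fin L => A q.1 q.2)
  simp only at h1
  rw [lintegral_map hfC (by fun_prop), lintegral_withDensity_eq_lintegral_mul _ (by fun_prop) hfC]
    at h1
  convert h1 using 1
  · refine lintegral_congr fun z => ?_
    congr 1
    ext i l
    simp [add_comm]
  · refine lintegral_congr fun z => ?_
    simp [frobeniusSq, frobeniusInner]

/-- The information about the target amplitude carried by the echo of a fixed signal matrix. -/
theorem klDiv_echo {N L : ℕ} (h : EuclideanSpace ℂ (Fin N)) (x : Matrix (Fin N) (Fin L) ℂ)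
    (α : ℝ≥0) :
    klDiv (((complexGaussian α).prod (gaussianMatrix N L)).map
        fun q => (echo h q.1 x q.2, q.1))
      ((((complexGaussian α).prod (gaussianMatrix N L)).map fun q => echo h q.1 x q.2).prod
        (complexGaussian α)) =
      ENNReal.ofReal (Real.log (1 + α * frobeniusSq (vecMulVec h.ofLp h.ofLp * x))) := by
  have hφ : Measurable fun q : ℂ × Matrix (Fin N) (Fin L) ℂ => echo h q.1 x q.2 :=
    Measurable.comp (g := fun q : Matrix (Fin N) (Fin L) ℂ × ℂ × Matrix (Fin N) (Fin L) ℂ =>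
      echo h q.2.1 q.1 q.2.2) (f := fun q => (x, q)) (measurable_echo h) measurable_prodMk_left
  refine klDiv_gaussian_channel (φ := fun q => echo h q.1 x q.2)
    (T := frobeniusInner (vecMulVec h.ofLp h.ofLp * x))
    hφ (measurable_frobeniusInner _) (fun b => ?_) (fun b y => ?_) α
  · simp only [echo_eq]
    rw [gaussianMatrix_map_const_add]
    simp only [frobeniusInner_smul_left, frobeniusSq_smul]
  · rw [echo_eq, frobeniusInner_smul_add]

end ISAC

/-! ### The sensing rate -/

theorem lemma1 {Ω : Type*} [MeasurableSpace Ω] (μ : Measure Ω) [IsProbabilityMeasure μ]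
    {N L : ℕ} (p : ℝ) (hp : 0 ≤ p) (αs : ℝ≥0)
    (h w : EuclideanSpace ℂ (Fin N)) (hw : ‖w‖ ^ 2 = 1)
    -- the unit-power data stream
    (s : Ω → EuclideanSpace ℂ (Fin L)) (hs_meas : AEMeasurable s μ)
    (hs : ∀ᵐ ω ∂μ, (L : ℝ)⁻¹ * ‖s ω‖ ^ 2 = 1)
    -- the target amplitude
    (β : Ω → ℂ) (hβ : HasLaw β (ISAC.complexGaussian αs) μ)
    -- the white Gaussian noise matrix: i.i.d. standard complex Gaussian entries
    (W : Ω → Matrix (Fin N) (Fin L) ℂ)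
    (hW : ∀ i l, HasLaw (fun ω => W ω i l) (ISAC.complexGaussian 1) μ)
    (hW_indep : iIndepFun (fun (il : Fin N × Fin L) ω => W ω il.1 il.2) μ)
    -- mutual independence of the data stream, the target amplitude and the noise
    (hsβ : IndepFun s β μ) (hsβW : IndepFun (fun ω => (s ω, β ω)) W μ) :
    ISAC.sensingRate μ p h w s β W =
      ENNReal.ofReal ((1 / (L : ℝ)) *
        Real.logb 2 (1 + p * L * αs * ‖h‖ ^ 2 * ‖h.ofLp ⬝ᵥ w.ofLp‖ ^ 2)) := by
  -- For `L = 0` the normalisation of `s` would read `0 = 1`.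
  have hL : (L : ℝ) ≠ 0 := by
    intro h0
    obtain ⟨ω, hω⟩ := hs.exists
    simp [h0] at hω
  have hL0 : (0 : ℝ) < L := lt_of_le_of_ne L.cast_nonneg hL.symm
  have hWm : AEMeasurable W μ := ISAC.aemeasurable_matrix fun i l => (hW i l).aemeasurable
  have hWlaw := ISAC.map_eq_gaussianMatrix hW hW_indep
  set X : Ω → Matrix (Fin N) (Fin L) ℂ := fun ω => ISAC.signal p w (s ω) with hX
  have hXm : AEMeasurable X μ := (ISAC.measurable_signal p w).comp_aemeasurable hs_meas
  obtain ⟨hind, hβW⟩ :=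
    ISAC.indepFun_prodMk_right hs_meas hβ.aemeasurable hWm hsβ hsβW
  have hXV : IndepFun X (fun ω => (β ω, W ω)) μ :=
    hind.comp (ISAC.measurable_signal p w) measurable_id
  have hVm : AEMeasurable (fun ω => (β ω, W ω)) μ := hβ.aemeasurable.prodMk hWm
  have hV : μ.map (fun ω => (β ω, W ω)) =
      (ISAC.complexGaussian αs).prod (ISAC.gaussianMatrix N L) := by
    rw [(indepFun_iff_map_prod_eq_prod_map_map hβ.aemeasurable hWm).1 hβW, hβ.map_eq, hWlaw]
  have hecho := ISAC.measurable_echo (L := L) h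
  have d1 := ISAC.condDistrib_of_indepFun hXm hVm hXV
    (f := fun q => (ISAC.echo h q.2.1 q.1 q.2.2, q.2.1)) (hecho.prodMk measurable_snd.fst)
  have d2 := ISAC.condDistrib_of_indepFun hXm hVm hXV hecho
  have d3 := ISAC.condDistrib_of_indepFun hXm hVm hXV (f := fun q => q.2.1) measurable_snd.fst
  have hB : Measurable fun x : Matrix (Fin N) (Fin L) ℂ =>
      ISAC.frobeniusSq (vecMulVec h.ofLp h.ofLp * x) :=
    ISAC.measurable_frobeniusSq.comp (ISAC.measurable_mul_left _)
  -- The squared length depends on the data only through `‖s‖² = L`, hence is almost surely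
  -- constant.
  have hc : ∀ᵐ x ∂(μ.map X), (ISAC.frobeniusSq (vecMulVec h.ofLp h.ofLp * x) : ℝ) =
      p * L * ‖h‖ ^ 2 * ‖h.ofLp ⬝ᵥ w.ofLp‖ ^ 2 := by
    rw [ae_map_iff hXm (measurableSet_eq_fun hB.coe_nnreal_real measurable_const)]
    filter_upwards [hs] with ω hω
    rw [hX, ISAC.frobeniusSq_vecMulVec_mul_signal hp, (inv_mul_eq_one₀ hL).1 hω]
  set r : ℝ := 1 + p * L * αs * ‖h‖ ^ 2 * ‖h.ofLp ⬝ᵥ w.ofLp‖ ^ 2 with hr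
  have hkl : ∀ᵐ x ∂(μ.map X),
      klDiv (condDistrib (fun ω => (ISAC.echo h (β ω) (X ω) (W ω), β ω)) X μ x)
        ((condDistrib (fun ω => ISAC.echo h (β ω) (X ω) (W ω)) X μ x).prod
          (condDistrib β X μ x)) = ENNReal.ofReal (Real.log r) := by
    filter_upwards [d1, d2, d3, hc] with x h1 h2 h3 hx
    have hβx : condDistrib β X μ x = ISAC.complexGaussian αs := by
      rw [h3, hV]
      change Measure.map Prod.fst _ = _
      simp
    rw [h1, h2, hβx, hV, ISAC.klDiv_echo, hx, hr]
    congr 3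
    ring
  have : IsProbabilityMeasure (μ.map X) := Measure.isProbabilityMeasure_map hXm
  have hlog2 : 0 < Real.log 2 := Real.log_pos one_lt_two
  rw [ISAC.sensingRate, ISAC.condMutualInfo, lintegral_congr_ae hkl, lintegral_const, measure_univ,
    mul_one, ← ENNReal.ofReal_div_of_pos hlog2, ENNReal.ofReal_mul (by positivity), one_div,
    ENNReal.ofReal_inv_of_pos hL0, ENNReal.ofReal_natCast, Real.logb]
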